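/- Let $M=(\mathcal S,\mathcal A,p,\mathbf r,\mu,\gamma)$ be a multi-objective Markov decision process with finite state space $\mathcal S$, finite non-empty action space $\mathcal A$, vector reward $\mathbf r:\mathcal S\times\mathcal A\times\mathcal S\to\mathbb R^m$ ($m\ge 1$) and discount factor $\gamma\in[0,1)$. Policies are maps $\pi:\mathcal S\to\mathcal A$, with multi-objective action values $\mathbf q^\pi(s,a)=\mathbb E_\pi[\sum_{i\ge 0}\gamma^i\mathbf R_{i}\mid S_0=s,A_0=a]$ and value vectors $\mathbf v^\pi=\mathbb E_{S_0\sim\mu}[\mathbf q^\pi(S_0,\pi(S_0))]\in\mathbb R^m$. Let $\mathcal W=\{\mathbf w\in\mathbb R^m: w_i\ge 0,\ \sum_i w_i=1\}$; for $\mathbf w\in\mathcal W$ write $q^\pi_{\mathbf w}=\mathbf q^\pi\cdot\mathbf w$, $v^\pi_{\mathbf w}=\mathbf v^\pi\cdot\mathbf w$ and $v^*_{\mathbf w}=\max_\pi v^\pi_{\mathbf w}$. For a finite set $\mathcal V\subset\mathbb R^m$, the corner weights $\mathrm{CornerWeights}(\mathcal V)$ are the $\mathbf w$-parts of the vertices of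 the polyhedron $\{(\mathbf w,x)\in\mathcal W\times\mathbb R:\mathbf v\cdot\mathbf w\le x\ \ \forall \mathbf v\in\mathcal V\}$. $\mathrm{NewPolicy}(\mathbf w,\Pi)$ is any procedure, possibly keeping a memory between calls, that returns a policy $\pi_{\mathbf w}$ and a flag $\mathrm{done}\in\{\mathrm{True},\mathrm{False}\}$. The algorithm GPI-LS starts with $\Pi=\{\pi_{\mathbf w}\}$, where $\pi_{\mathbf w}$ is returned by $\mathrm{NewPolicy}$ for $\mathbf w=(1,0,\dots,0)$, and with $\mathcal M=\emptyset$, and repeats the following iteration. Let $\mathcal V=\{\mathbf v^\pi:\pi\in\Pi\}$ and $\mathcal W_{\mathrm{corner}}=\mathrm{CornerWeights}(\mathcal V)\setminus\mathcal M$. If $\mathcal W_{\mathrm{corner}}=\emptyset$, return $\Pi,\mathcal V$. Otherwise pick $\mathbf w\in\arg\max_{\mathbf w\in\mathcal W_{\mathrm{corner}}}(v^{\mathrm{GPI}}_{\mathbf w}-\max_{\pi\in\Pi}v^\pi_{\mathbf w})$ (ties broken arbitrarily), where $v^{\mathrm{GPI}}_{\mathbf w}$ is the scalarized value of a policy $\pi$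 with $\pi(s)\in\arg\max_a\max_{\pi'\in\Pi}q^{\pi'}_{\mathbf w}(s,a)$ for all $s$; call $\mathrm{NewPolicy}(\mathbf w,\Pi)$; if it returns $\mathrm{done}=\mathrm{True}$, add $\mathbf w$ to $\mathcal M$; add the returned policy to $\Pi$; and remove from $\Pi$ the policies that do not maximize $v^\pi_{\mathbf w'}$ over $\pi\in\Pi$ for any $\mathbf w'\in\mathcal W$. Suppose that $\mathrm{NewPolicy}$ produces an $\epsilon$-optimal policy whenever it returns $\mathrm{done}=\mathrm{True}$, i.e. $v^*_{\mathbf w}-v^{\pi_{\mathbf w}}_{\mathbf w}\le\epsilon$ for a call with $\mathbf w\in\mathcal W$ that returns $\pi_{\mathbf w}$ and $\mathrm{done}=\mathrm{True}$. Then GPI-LS is guaranteed to return an $\epsilon$-CCS: (i) as long as it has not returned, a further iteration is possible; (ii) whenever it returns a set $\Pi$, this set is an $\epsilon$-CCS, i.e. $\Pi\neq\emptyset$ and $v^*_{\mathbf w}-\max_{\pi\in\Pi}v^\pi_{\mathbf w}\le\epsilon$ for every $\mathbf w\in\mathcal W$; (iii) in every execution in which $\mathrm{NewPolicy}$ eventually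 meets its termination condition (whenever it is called infinitely often for the same weight vector, at least one of these calls returns $\mathrm{done}=\mathrm{True}$), GPI-LS returns, after finitely many iterations, an $\epsilon$-CCS. -/

import Mathlib

open MeasureTheory ProbabilityTheory Filter

noncomputable section

namespace MORL

/-- A multi-objective Markov decision process `(S, A, p, r, μ, γ)` with `m` objectives. -/
structure MOMDP (S A : Type*) [MeasurableSpace S] [MeasurableSpace A] (m : ℕ) where
  /-- transition probabilities `p(· | s, a)` -/
  p : Kernel (S × A) S
  markov : IsMarkovKernel p
  /-- vector reward `r(s, a, s')` -/
  r : S → A → S → Fin m → ℝ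
  /-- initial state distribution -/
  μ : Measure S
  prob : IsProbabilityMeasure μ
  /-- discount factor -/
  γ : ℝ
  γ_nonneg : 0 ≤ γ
  γ_lt_one : γ < 1

/-- A policy maps states to actions. -/
abbrev Policy (S A : Type*) := S → A

/-- A weight vector; the admissible ones are the members of `stdSimplex ℝ (Fin m)`. -/
abbrev Weight (m : ℕ) := Fin m → ℝ

namespace MOMDP

variable {S A : Type*} [MeasurableSpace S] [MeasurableSpace A] {m : ℕ} (M : MOMDP S A m)

/-- Law of the state-action pair at time `n + 1` given the state-action pairs up to time `n`, under
the policy `π`: draw `s'` from `p(· | s, a)` and take the action `π s'`. -/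
def stepKernel (π : Policy S A) (n : ℕ) : Kernel (Π _ : Finset.Iic n, S × A) (S × A) :=
  (M.p.map (fun s' => (s', π s'))).comap
    (fun h => h ⟨n, Finset.mem_Iic.2 le_rfl⟩) (measurable_pi_apply _)

instance [DiscreteMeasurableSpace S] (π : Policy S A) (n : ℕ) :
    IsMarkovKernel (M.stepKernel π n) := by
  have := M.markov
  have : IsMarkovKernel (M.p.map (fun s' => (s', π s'))) :=
    Kernel.IsMarkovKernel.map _ Measurable.of_discrete
  unfold stepKernel
  infer_instance

/-- Law of the trajectory `(S_0, A_0), (S_1, A_1), …` conditioned on `S_0 = s`, `A_0 = a`, with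
all later actions chosen by `π`. -/
def trajectory [DiscreteMeasurableSpace S] (π : Policy S A) (s : S) (a : A) :
    Measure (ℕ → S × A) :=
  Kernel.traj (X := fun _ => S × A) (M.stepKernel π) 0 (fun _ => (s, a))

/-- Discounted return of a trajectory under objective `i`. -/
def discountedReturn (i : Fin m) (τ : ℕ → S × A) : ℝ :=
  ∑' t : ℕ, M.γ ^ t * M.r (τ t).1 (τ t).2 (τ (t + 1)).1 i

variable [DiscreteMeasurableSpace S]

/-- Multi-objective action-value function `q^π(s, a)`. -/
def qVec (π : Policy S A) (s : S) (a : A) : Fin m → ℝ :=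
  fun i => ∫ τ, M.discountedReturn i τ ∂(M.trajectory π s a)

/-- Multi-objective value vector `v^π` under the initial state distribution. -/
def valueVec (π : Policy S A) : Fin m → ℝ :=
  fun i => ∫ s, M.qVec π s (π s) i ∂M.μ

/-- Scalarized action value `q^π_w(s, a) = q^π(s, a) · w`. -/
def qScal (π : Policy S A) (w : Weight m) (s : S) (a : A) : ℝ := M.qVec π s a ⬝ᵥ w

/-- Scalarized value `v^π_w = v^π · w`. -/
def valueScal (π : Policy S A) (w : Weight m) : ℝ := M.valueVec π ⬝ᵥ w

/-- Optimal scalarized value `v*_w`, the maximum over all policies. -/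
def optValue (w : Weight m) : ℝ := ⨆ π : Policy S A, M.valueScal π w

/-- `max_{π ∈ Pol} v^π_w`. -/
def maxValue (Pol : Set (Policy S A)) (w : Weight m) : ℝ := ⨆ π : Pol, M.valueScal π w

/-- Utility loss `Δ(w, Pol) = v*_w - max_{π ∈ Pol} v^π_w`. -/
def utilityLoss (w : Weight m) (Pol : Set (Policy S A)) : ℝ := M.optValue w - M.maxValue Pol w

/-- The policy set `Pol` (with its set of value vectors) is an `ε`-CCS: it is non-empty and its
utility loss is at most `ε` at every weight vector of the simplex. -/
def IsEpsCCS (ε : ℝ) (Pol : Set (Policy S A)) : Prop :=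
  Pol.Nonempty ∧ ∀ w ∈ stdSimplex ℝ (Fin m), M.utilityLoss w Pol ≤ ε

/-- `π` is a GPI policy for the policy set `Pol` and the weight vector `w`: for every state `s`,
`π s ∈ argmax_a max_{π' ∈ Pol} q^{π'}_w(s, a)`. -/
def IsGPIPolicy (Pol : Set (Policy S A)) (w : Weight m) (π : Policy S A) : Prop :=
  ∀ s a, (⨆ π' : Pol, M.qScal π' w s a) ≤ ⨆ π' : Pol, M.qScal π' w s (π s)

/-- `RemoveDominated`: discard the policies that are not best in `Pol` for any weight vector. -/
def removeDominated (Pol : Set (Policy S A)) : Set (Policy S A) :=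
  {π ∈ Pol | ∃ w ∈ stdSimplex ℝ (Fin m), ∀ π' ∈ Pol, M.valueScal π' w ≤ M.valueScal π w}

end MOMDP

/-- The polyhedron of all `(w, x)` with `w` in the simplex and `v · w - x ≤ 0` for `v ∈ V`. -/
def cornerPolyhedron {m : ℕ} (V : Set (Fin m → ℝ)) : Set (Weight m × ℝ) :=
  {x | (∀ v ∈ V, v ⬝ᵥ x.1 - x.2 ≤ 0) ∧ x.1 ∈ stdSimplex ℝ (Fin m)}

/-- Corner weights of `V`: the weight parts of the vertices of the polyhedron. -/
def cornerWeights {m : ℕ} (V : Set (Fin m → ℝ)) : Set (Weight m) :=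
  Prod.fst '' (cornerPolyhedron V).extremePoints ℝ

/-- What a call of `NewPolicy` returns: a policy, the flag `done`, and the new content of the
memory. -/
structure Reply (S A Mem : Type*) where
  policy : Policy S A
  done : Bool
  mem : Mem

/-- A procedure `NewPolicy(w, Pol)`. It may keep a memory of arbitrary type between calls (partially
trained policies, collected experience, a random seed, …), so that repeated calls with the same
arguments can give different replies. -/
abbrev NewPolicyProc (S A Mem : Type*) (m : ℕ) :=
  Mem → Weight m → Set (Policy S A) → Reply S A Mem

section GPILS

variable {S A Mem : Type*} [MeasurableSpace S] [MeasurableSpace A] [DiscreteMeasurableSpace S]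
  {m : ℕ} (M : MOMDP S A m)

/-- Whenever `NewPolicy`, called for a weight vector of the simplex, reports `done`, the policy that
it returns is `ε`-optimal for that weight vector. -/
def EpsOptimalWhenDone (NewPolicy : NewPolicyProc S A Mem m) (ε : ℝ) : Prop :=
  ∀ (c : Mem) (w : Weight m) (Pol : Set (Policy S A)), w ∈ stdSimplex ℝ (Fin m) →
    (NewPolicy c w Pol).done = true →
      M.optValue w - M.valueScal (NewPolicy c w Pol).policy w ≤ ε

/-- State of GPI-LS at the head of its loop: the policy set, the set of finished weight
vectors, and the memory of `NewPolicy`. The value vectors are those of the policies. -/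
structure State (S A Mem : Type*) (m : ℕ) where
  policies : Set (Policy S A)
  support : Set (Weight m)
  mem : Mem

/-- The state in which the loop is entered: one policy, obtained for `w = (1, 0, …, 0)`. -/
def startState [NeZero m] (NewPolicy : NewPolicyProc S A Mem m) (c₀ : Mem) : State S A Mem m where
  policies := {(NewPolicy c₀ (Pi.single 0 1) ∅).policy}
  support := ∅
  mem := (NewPolicy c₀ (Pi.single 0 1) ∅).mem

/-- The candidates `CornerWeights(V) \ M` of the current iteration. -/
def State.candidates (x : State S A Mem m) : Set (Weight m) :=
  cornerWeights (M.valueVec '' x.policies) \ x.support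

/-- The algorithm returns (its policy set) at the state `x`. -/
def State.Returns (x : State S A Mem m) : Prop := x.candidates M = ∅

/-- `w ∈ argmax_{u ∈ candidates} (v^GPI_u - max_{π ∈ Pol} v^π_u)`, where `gpi u` is any GPI policy
for `u`. -/
def State.Selects (x : State S A Mem m) (w : Weight m) : Prop :=
  ∃ gpi : Weight m → Policy S A, (∀ u, M.IsGPIPolicy x.policies u (gpi u)) ∧
    w ∈ x.candidates M ∧
    ∀ u ∈ x.candidates M,
      M.valueScal (gpi u) u - M.maxValue x.policies u ≤
        M.valueScal (gpi w) w - M.maxValue x.policies w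

/-- The reply of `NewPolicy` when it is called for `w` at the state `x`. -/
def State.reply (NewPolicy : NewPolicyProc S A Mem m) (x : State S A Mem m) (w : Weight m) :
    Reply S A Mem :=
  NewPolicy x.mem w x.policies

/-- The state after an iteration that starts at `x` and selects `w`. -/
def State.update (NewPolicy : NewPolicyProc S A Mem m) (x : State S A Mem m) (w : Weight m) :
    State S A Mem m where
  policies := M.removeDominated (insert (x.reply NewPolicy w).policy x.policies)
  support := x.support ∪ {u | u = w ∧ (x.reply NewPolicy w).done = true}
  mem := (x.reply NewPolicy w).mem

/-- One iteration of the loop from `x` to `y`, in which `w` is selected. -/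
def Iteration (NewPolicy : NewPolicyProc S A Mem m) (x : State S A Mem m) (w : Weight m)
    (y : State S A Mem m) : Prop :=
  x.Selects M w ∧ y = x.update M NewPolicy w

/-- States at the head of the loop that some execution of GPI-LS reaches. -/
inductive Reachable [NeZero m] (NewPolicy : NewPolicyProc S A Mem m) (c₀ : Mem) :
    State S A Mem m → Prop
  | start : Reachable NewPolicy c₀ (startState NewPolicy c₀)
  | step {x y : State S A Mem m} {w : Weight m} :
      Reachable NewPolicy c₀ x → Iteration M NewPolicy x w y → Reachable NewPolicy c₀ y

/-- A complete execution of GPI-LS: `x k` is the state after `k` iterations and `w k` the weight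
vector selected in the next iteration; once the algorithm has returned, the state stays the same
(and `w k` has no meaning). -/
def IsExecution [NeZero m] (NewPolicy : NewPolicyProc S A Mem m) (c₀ : Mem)
    (x : ℕ → State S A Mem m) (w : ℕ → Weight m) : Prop :=
  x 0 = startState NewPolicy c₀ ∧
    ∀ k, ((x k).Returns M ∧ x (k + 1) = x k) ∨
      (¬ (x k).Returns M ∧ Iteration M NewPolicy (x k) (w k) (x (k + 1)))

/-- In the execution, `NewPolicy` does not go on for ever without meeting its termination
condition: if it is called infinitely often for the weight vector `u`, then one of these calls
reports `done`. -/
def EventuallyDone (NewPolicy : NewPolicyProc S A Mem m)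
    (x : ℕ → State S A Mem m) (w : ℕ → Weight m) : Prop :=
  ∀ u : Weight m, (∃ᶠ k in atTop, ¬ (x k).Returns M ∧ w k = u) →
    ∃ k, ¬ (x k).Returns M ∧ w k = u ∧ ((x k).reply NewPolicy u).done = true

end GPILS

end MORL

end

namespace MORL

open Topology

/-! ### Vertices of the corner polyhedron. -/

section Polyhedron

variable {m : ℕ} {V : Set (Fin m → ℝ)}

/-! Beyond finiteness of the policy space and linearity of scalarized values in `w`, nothing about
the MDP matters.

Correctness: for a fixed policy `π`, the gap `v^π · w - x` is linear on the corner polyhedron, so it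
is maximal at a vertex (`exists_extremePoint_isMaxOn`). Hence loss at most `ε` at the corner weights
gives loss at most `ε` on the whole simplex (`MOMDP.isEpsCCS_of_cornerWeights`). On return every
corner weight is finished, and the loss at finished weights stays at most `ε` because pruning never
lowers the upper envelope.

Termination: each policy set has finitely many corner weights (`finite_cornerWeights`) and there are
finitely many policy sets. An endless run would select some weight infinitely often; once a call for
it reports `done`, it can never be selected again. -/

theorem eventually_extrapolate_nonpos {a b : ℝ} (ha : a ≤ 0) (hab : a = 0 → b = 0) :
    ∀ᶠ δ : ℝ in 𝓝[>] 0, a - δ * (b - a) ≤ 0 := by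
  rcases ha.eq_or_lt with h | h
  · simp [h, hab h]
  · have hc : Tendsto (fun δ : ℝ => a - δ * (b - a)) (𝓝 0) (𝓝 (a - 0 * (b - a))) :=
      Continuous.tendsto (by fun_prop) 0
    rw [zero_mul, sub_zero] at hc
    exact ((hc.eventually_lt_const h).filter_mono nhdsWithin_le_nhds).mono fun _ => le_of_lt

/-- A vertex is determined by the constraints that are active at it. -/
theorem eq_of_active_eq (hV : V.Finite) {z z' : Weight m × ℝ}
    (hz : z ∈ (cornerPolyhedron V).extremePoints ℝ) (hz' : z' ∈ cornerPolyhedron V)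
    (hact : ∀ v ∈ V, v ⬝ᵥ z.1 = z.2 → v ⬝ᵥ z'.1 = z'.2)
    (hzero : ∀ i, z.1 i = 0 → z'.1 i = 0) : z' = z := by
  obtain ⟨⟨hzV, hznn, hzsum⟩, hext⟩ := hz
  have e1 : ∀ᶠ δ : ℝ in 𝓝[>] 0, ∀ v ∈ V,
      (v ⬝ᵥ z.1 - z.2) - δ * ((v ⬝ᵥ z'.1 - z'.2) - (v ⬝ᵥ z.1 - z.2)) ≤ 0 :=
    (eventually_all_finite hV).2 fun v hv => eventually_extrapolate_nonpos (hzV v hv)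
      fun h => sub_eq_zero.2 (hact v hv (sub_eq_zero.1 h))
  have e2 : ∀ᶠ δ : ℝ in 𝓝[>] 0, ∀ i, -z.1 i - δ * (-z'.1 i - -z.1 i) ≤ 0 :=
    eventually_all.2 fun i => eventually_extrapolate_nonpos (neg_nonpos.2 (hznn i))
      fun h => neg_eq_zero.2 (hzero i (neg_eq_zero.1 h))
  obtain ⟨δ, h1, h2, hδ⟩ := (e1.and (e2.and self_mem_nhdsWithin)).exists
  have hδ : 0 < δ := hδ
  -- Step slightly past `z` on the line from `z'`: inactive constraints have slack, and active ones
  -- stay equalities.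
  have hmem : z - δ • (z' - z) ∈ cornerPolyhedron V := by
    refine ⟨fun v hv => ?_, fun i => ?_, ?_⟩
    · have := h1 v hv
      simp only [Prod.fst_sub, Prod.smul_fst, Prod.snd_sub, Prod.smul_snd, dotProduct_sub,
        dotProduct_smul, smul_eq_mul]
      linarith
    · have := h2 i
      simp only [Prod.fst_sub, Prod.smul_fst, Pi.sub_apply, Pi.smul_apply, smul_eq_mul]
      linarith
    · simp only [Prod.fst_sub, Prod.smul_fst, Pi.sub_apply, Pi.smul_apply, smul_eq_mul,
        Finset.sum_sub_distrib, ← Finset.mul_sum, hzsum, hz'.2.2]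
      ring
  have hseg : z ∈ openSegment ℝ (z - δ • (z' - z)) z' := by
    have hne : 1 + δ ≠ 0 := by positivity
    refine ⟨1 / (1 + δ), δ / (1 + δ), by positivity, by positivity, by field_simp, ?_⟩
    have hone : 1 / (1 + δ) + 1 / (1 + δ) * δ = 1 := by field_simp
    have hdiv : δ / (1 + δ) = 1 / (1 + δ) * δ := by ring
    calc _ = (1 / (1 + δ) + 1 / (1 + δ) * δ) • z := by rw [hdiv]; module
      _ = z := by rw [hone, one_smul]
  have hleft := hext hmem hz' hseg
  have : δ • (z' - z) = 0 := by simpa using hleft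
  exact sub_eq_zero.1 ((smul_eq_zero.1 this).resolve_left hδ.ne')

/-- Vertices inject into their sets of active constraints, of which there are finitely many. -/
theorem finite_extremePoints_cornerPolyhedron (hV : V.Finite) :
    ((cornerPolyhedron V).extremePoints ℝ).Finite := by
  let active : Weight m × ℝ → Set (Fin m → ℝ) × Set (Fin m) :=
    fun z => ({v ∈ V | v ⬝ᵥ z.1 = z.2}, {i | z.1 i = 0})
  refine Set.Finite.of_injOn (f := active) (t := V.powerset ×ˢ Set.univ)
    (fun z _ => ⟨fun v hv => hv.1, trivial⟩) (fun z hz z' hz' h => ?_)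
    (hV.powerset.prod Set.finite_univ)
  obtain ⟨hv, hi⟩ := Prod.ext_iff.1 h
  exact (eq_of_active_eq hV hz hz'.1 (fun v hvV hvz => ((Set.ext_iff.1 hv v).1 ⟨hvV, hvz⟩).2)
    (fun i => (Set.ext_iff.1 hi i).1)).symm

theorem finite_cornerWeights (hV : V.Finite) : (cornerWeights V).Finite :=
  (finite_extremePoints_cornerPolyhedron hV).image _

theorem cornerWeights_subset_stdSimplex : cornerWeights V ⊆ stdSimplex ℝ (Fin m) := by
  rintro _ ⟨z, hz, rfl⟩
  exact hz.1.2

theorem isClosed_cornerPolyhedron : IsClosed (cornerPolyhedron V) := by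
  have h : cornerPolyhedron V =
      (⋂ v ∈ V, {x : Weight m × ℝ | v ⬝ᵥ x.1 - x.2 ≤ 0}) ∩ Prod.fst ⁻¹' stdSimplex ℝ (Fin m) := by
    ext x
    simp [cornerPolyhedron]
  rw [h]
  refine IsClosed.inter (isClosed_biInter fun v _ => isClosed_le ?_ continuous_const)
    ((isCompact_stdSimplex ℝ (Fin m)).isClosed.preimage continuous_fst)
  unfold dotProduct
  fun_prop

/-- The polyhedron is unbounded only in the direction of growing `x`; the level `c` caps `x` from
above, and any one `v ∈ V` bounds it from below. -/
theorem isCompact_superlevel_cornerPolyhedron (hV : V.Nonempty) (u : Fin m → ℝ) (c : ℝ) :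
    IsCompact {z ∈ cornerPolyhedron V | c ≤ u ⬝ᵥ z.1 - z.2} := by
  obtain ⟨v, hv⟩ := hV
  have hcont (u : Fin m → ℝ) : Continuous fun w : Weight m => u ⬝ᵥ w := by
    unfold dotProduct
    fun_prop
  obtain ⟨b, hb⟩ := ((isCompact_stdSimplex ℝ (Fin m)).image (hcont u)).bddAbove
  obtain ⟨a, ha⟩ := ((isCompact_stdSimplex ℝ (Fin m)).image (hcont v)).bddBelow
  refine ((isCompact_stdSimplex ℝ (Fin m)).prod (isCompact_Icc (a := a) (b := b - c))).of_isClosed_subset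
    (isClosed_cornerPolyhedron.inter (isClosed_le continuous_const
      (((hcont u).comp continuous_fst).sub continuous_snd))) ?_
  rintro z ⟨hz, hc⟩
  have h1 := hb (Set.mem_image_of_mem _ hz.2)
  have h2 := ha (Set.mem_image_of_mem _ hz.2)
  have h3 := hz.1 v hv
  exact ⟨hz.2, by linarith, by linarith⟩

/-- A linear functional `(w, x) ↦ u · w - x` attains its maximum over the polyhedron at a
vertex. -/
theorem exists_extremePoint_isMaxOn [NeZero m] (hV : V.Finite) (hne : V.Nonempty)
    (u : Fin m → ℝ) : ∃ z ∈ (cornerPolyhedron V).extremePoints ℝ,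
      ∀ y ∈ cornerPolyhedron V, u ⬝ᵥ y.1 - y.2 ≤ u ⬝ᵥ z.1 - z.2 := by
  let l : StrongDual ℝ (Weight m × ℝ) :=
    (∑ i, u i • ContinuousLinearMap.proj (R := ℝ) (φ := fun _ : Fin m => ℝ) i).comp
      (ContinuousLinearMap.fst ℝ _ _) - ContinuousLinearMap.snd ℝ _ _
  have hl (z : Weight m × ℝ) : l z = u ⬝ᵥ z.1 - z.2 := by
    simp [l, dotProduct]
  obtain ⟨C, hC⟩ := (hV.image fun v => v ⬝ᵥ (Pi.single 0 1 : Weight m)).bddAbove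
  have hy : ((Pi.single 0 1 : Weight m), C) ∈ cornerPolyhedron V :=
    ⟨fun v hv => sub_nonpos.2 (hC (Set.mem_image_of_mem _ hv)), single_mem_stdSimplex ℝ 0⟩
  obtain ⟨z, ⟨hz, hyz⟩, hmax⟩ :=
    (isCompact_superlevel_cornerPolyhedron hne u _).exists_isMaxOn ⟨_, hy, le_rfl⟩
      l.continuous.continuousOn
  have hmax' : ∀ y ∈ cornerPolyhedron V, l y ≤ l z := fun y hyP => by
    rcases le_total (l y) (l z) with h | h
    · exact h
    · exact hmax ⟨hyP, hyz.trans (by rwa [hl, hl] at h)⟩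
  -- The maximizing face is a superlevel set, hence compact, so it has an extreme point; being
  -- exposed, it passes that point on as a vertex of the polyhedron.
  have hface : {y ∈ cornerPolyhedron V | ∀ x ∈ cornerPolyhedron V, l x ≤ l y} =
      {y ∈ cornerPolyhedron V | u ⬝ᵥ z.1 - z.2 ≤ u ⬝ᵥ y.1 - y.2} := by
    ext y
    simp only [Set.mem_ofPred_eq, ← hl]
    exact and_congr_right fun _ => ⟨fun h => h z hz, fun h x hx => (hmax' x hx).trans h⟩
  have hcomp : IsCompact {y ∈ cornerPolyhedron V | ∀ x ∈ cornerPolyhedron V, l x ≤ l y} :=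
    hface ▸ isCompact_superlevel_cornerPolyhedron hne u _
  obtain ⟨e, he⟩ := hcomp.extremePoints_nonempty ⟨z, hz, hmax'⟩
  have hexp : IsExposed ℝ (cornerPolyhedron V)
      {y ∈ cornerPolyhedron V | ∀ x ∈ cornerPolyhedron V, l x ≤ l y} := fun _ => ⟨l, rfl⟩
  refine ⟨e, hexp.isExtreme.extremePoints_subset_extremePoints he, fun y hyP => ?_⟩
  simpa only [hl] using he.1.2 y hyP

end Polyhedron

/-! ### Upper envelopes of policy values and utility loss. -/

section Values

variable {S A : Type*} [Finite A] [MeasurableSpace S] [MeasurableSpace A]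
  [DiscreteMeasurableSpace S] {m : ℕ} (M : MOMDP S A m)

theorem MOMDP.exists_isGPIPolicy [Nonempty A] (Pol : Set (Policy S A)) (w : Weight m) :
    ∃ π, M.IsGPIPolicy Pol w π := by
  choose π hπ using fun s => Finite.exists_max fun a => ⨆ π' : Pol, M.qScal π' w s a
  exact ⟨π, hπ⟩

variable [Finite S]

theorem MOMDP.valueScal_le_maxValue {Pol : Set (Policy S A)} {π : Policy S A} (hπ : π ∈ Pol)
    (w : Weight m) : M.valueScal π w ≤ M.maxValue Pol w :=
  le_ciSup (f := fun π : Pol => M.valueScal π w) (Set.finite_range _).bddAbove ⟨π, hπ⟩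

theorem MOMDP.exists_valueScal_eq_maxValue {Pol : Set (Policy S A)} (hne : Pol.Nonempty)
    (w : Weight m) : ∃ π ∈ Pol, M.valueScal π w = M.maxValue Pol w := by
  have := hne.to_subtype
  obtain ⟨π, hπ⟩ := exists_eq_ciSup_of_finite (f := fun π : Pol => M.valueScal π w)
  exact ⟨π, π.2, hπ⟩

/-- A policy that is best at `w` survives pruning, with `w` itself as witness. -/
theorem MOMDP.maxValue_le_removeDominated {Pol : Set (Policy S A)} (hne : Pol.Nonempty)
    {w : Weight m} (hw : w ∈ stdSimplex ℝ (Fin m)) :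
    M.maxValue Pol w ≤ M.maxValue (M.removeDominated Pol) w := by
  obtain ⟨π, hπ, h⟩ := M.exists_valueScal_eq_maxValue hne w
  have hmem : π ∈ M.removeDominated Pol :=
    ⟨hπ, w, hw, fun π' hπ' => (M.valueScal_le_maxValue hπ' w).trans h.ge⟩
  exact h.ge.trans (M.valueScal_le_maxValue hmem w)

theorem MOMDP.removeDominated_nonempty [NeZero m] {Pol : Set (Policy S A)} (hne : Pol.Nonempty) :
    (M.removeDominated Pol).Nonempty := by
  obtain ⟨π, hπ, h⟩ := M.exists_valueScal_eq_maxValue hne (Pi.single 0 1)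
  exact ⟨π, hπ, _, single_mem_stdSimplex ℝ 0,
    fun π' hπ' => (M.valueScal_le_maxValue hπ' _).trans h.ge⟩

theorem MOMDP.maxValue_mono {Pol Pol' : Set (Policy S A)} (hne : Pol.Nonempty) (h : Pol ⊆ Pol')
    (w : Weight m) : M.maxValue Pol w ≤ M.maxValue Pol' w := by
  obtain ⟨π, hπ, h'⟩ := M.exists_valueScal_eq_maxValue hne w
  exact h'.ge.trans (M.valueScal_le_maxValue (h hπ) w)

/-- Utility loss is largest at a corner weight. -/
theorem MOMDP.isEpsCCS_of_cornerWeights [Nonempty A] [NeZero m] {ε : ℝ} {Pol : Set (Policy S A)}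
    (hne : Pol.Nonempty)
    (h : ∀ w ∈ cornerWeights (M.valueVec '' Pol), M.utilityLoss w Pol ≤ ε) :
    M.IsEpsCCS ε Pol := by
  refine ⟨hne, fun w hw => sub_le_iff_le_add.2 (ciSup_le fun π => ?_)⟩
  obtain ⟨z, hz, hmax⟩ := exists_extremePoint_isMaxOn (Pol.toFinite.image M.valueVec)
    (hne.image _) (M.valueVec π)
  have hwP : (w, M.maxValue Pol w) ∈ cornerPolyhedron (M.valueVec '' Pol) := by
    refine ⟨?_, hw⟩
    rintro _ ⟨π', hπ', rfl⟩
    exact sub_nonpos.2 (M.valueScal_le_maxValue hπ' w)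
  obtain ⟨π', hπ', hzmax⟩ := M.exists_valueScal_eq_maxValue hne z.1
  have h1 : M.valueScal π w - M.maxValue Pol w ≤ M.valueScal π z.1 - z.2 := hmax _ hwP
  -- The vertex lies on or above the envelope, so the gap of `π` there is at most the utility loss
  -- at `z.1`.
  have h2 : M.valueScal π' z.1 - z.2 ≤ 0 := hz.1.1 _ (Set.mem_image_of_mem _ hπ')
  have h3 : M.optValue z.1 - M.maxValue Pol z.1 ≤ ε := h _ (Set.mem_image_of_mem _ hz)
  have h4 : M.valueScal π z.1 ≤ M.optValue z.1 :=
    le_ciSup (f := fun π => M.valueScal π z.1) (Set.finite_range _).bddAbove π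
  linarith

end Values

/-! ### Progress, invariant and termination of GPI-LS. -/

section GPILS

variable {S A Mem : Type*} [MeasurableSpace S] [MeasurableSpace A] [DiscreteMeasurableSpace S]
  {m : ℕ} {M : MOMDP S A m} {ε : ℝ} {NewPolicy : NewPolicyProc S A Mem m} {c₀ : Mem}

section Execution

variable {x : ℕ → State S A Mem m} {w : ℕ → Weight m}

theorem IsExecution.reachable [NeZero m] (hex : IsExecution M NewPolicy c₀ x w) (k : ℕ) :
    Reachable M NewPolicy c₀ (x k) := by
  induction k with
  | zero => exact hex.1 ▸ Reachable.start
  | succ k ih =>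
    rcases hex.2 k with ⟨_, h⟩ | ⟨_, h⟩
    · exact h ▸ ih
    · exact ih.step h

theorem IsExecution.support_mono [NeZero m] (hex : IsExecution M NewPolicy c₀ x w) :
    Monotone fun k => (x k).support := by
  refine monotone_nat_of_le_succ fun k => ?_
  rcases hex.2 k with ⟨_, h⟩ | ⟨_, _, h⟩
  · exact h ▸ le_rfl
  · exact h ▸ Set.subset_union_left

end Execution

variable [Finite S] [Finite A]

theorem State.exists_selects [Nonempty A] {x : State S A Mem m} (hx : ¬ x.Returns M) :
    ∃ w, x.Selects M w := by
  choose gpi hgpi using M.exists_isGPIPolicy x.policies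
  obtain ⟨w, hw, hmax⟩ := Set.exists_max_image (x.candidates M)
    (fun u => M.valueScal (gpi u) u - M.maxValue x.policies u)
    ((finite_cornerWeights (x.policies.toFinite.image _)).subset Set.sdiff_subset)
    (Set.nonempty_iff_ne_empty.2 hx)
  exact ⟨w, gpi, hgpi, hw, hmax⟩

/-- At a reachable state there is a policy, and the utility loss is at most `ε` at every finished
weight vector. -/
theorem Reachable.policies_nonempty_and_utilityLoss_le [NeZero m]
    (hNew : EpsOptimalWhenDone M NewPolicy ε) {x : State S A Mem m}
    (hx : Reachable M NewPolicy c₀ x) :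
    x.policies.Nonempty ∧ ∀ w ∈ x.support,
      w ∈ stdSimplex ℝ (Fin m) ∧ M.utilityLoss w x.policies ≤ ε := by
  induction hx with
  | start => exact ⟨Set.singleton_nonempty _, fun w hw => hw.elim⟩
  | @step x y w _ hit ih =>
    obtain ⟨⟨_, _, hcand, _⟩, rfl⟩ := hit
    obtain ⟨hne, hloss⟩ := ih
    have hne' : (insert (x.reply NewPolicy w).policy x.policies).Nonempty :=
      Set.insert_nonempty _ _
    refine ⟨M.removeDominated_nonempty hne', ?_⟩
    -- For an old finished weight the envelope has not dropped; for the new one, the inserted policy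
    -- is `ε`-optimal.
    rintro u (hu | ⟨rfl, hdone⟩)
    · have hs := (hloss u hu).1
      exact ⟨hs, (sub_le_sub_left ((M.maxValue_mono hne (Set.subset_insert _ _) u).trans
        (M.maxValue_le_removeDominated hne' hs)) _).trans (hloss u hu).2⟩
    · have hs := cornerWeights_subset_stdSimplex hcand.1
      exact ⟨hs, (sub_le_sub_left ((M.valueScal_le_maxValue (Set.mem_insert _ _) u).trans
        (M.maxValue_le_removeDominated hne' hs)) _).trans (hNew x.mem u x.policies hs hdone)⟩

theorem Reachable.isEpsCCS_of_returns [Nonempty A] [NeZero m]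
    (hNew : EpsOptimalWhenDone M NewPolicy ε) {x : State S A Mem m}
    (hx : Reachable M NewPolicy c₀ x) (hret : x.Returns M) : M.IsEpsCCS ε x.policies := by
  obtain ⟨hne, hloss⟩ := hx.policies_nonempty_and_utilityLoss_le hNew
  exact M.isEpsCCS_of_cornerWeights hne fun w hw => (hloss w (Set.sdiff_eq_empty.1 hret hw)).2

theorem IsExecution.exists_returns [NeZero m] {x : ℕ → State S A Mem m} {w : ℕ → Weight m}
    (hex : IsExecution M NewPolicy c₀ x w)
    (hdone : EventuallyDone M NewPolicy x w) : ∃ n, (x n).Returns M := by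
  by_contra! hnot
  have hit (k : ℕ) : Iteration M NewPolicy (x k) (w k) (x (k + 1)) :=
    ((hex.2 k).resolve_left fun h => hnot k h.1).2
  have hcand (k : ℕ) : w k ∈ (x k).candidates M := by
    obtain ⟨⟨_, _, h, _⟩, _⟩ := hit k
    exact h
  -- Ranging over all policy sets makes the bound independent of the iteration, so the pigeonhole
  -- principle applies to `w`.
  have hfin : (⋃ Pol : Set (Policy S A), cornerWeights (M.valueVec '' Pol)).Finite :=
    Set.finite_iUnion fun Pol => finite_cornerWeights (Pol.toFinite.image _)
  have hrange : (Set.range w).Finite := hfin.subset <| by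
    rintro _ ⟨k, rfl⟩
    exact Set.mem_iUnion.2 ⟨_, (hcand k).1⟩
  have := hrange.to_subtype
  obtain ⟨⟨u, _⟩, hu⟩ := Finite.exists_infinite_fiber (Set.rangeFactorization w)
  have hfreq : ∃ᶠ k in atTop, w k = u := by
    rw [Nat.frequently_atTop_iff_infinite]
    refine (Set.infinite_coe_iff.1 hu).mono fun k hk => ?_
    simpa [Set.rangeFactorization, Subtype.ext_iff] using hk
  obtain ⟨k, -, hk, hkd⟩ := hdone u (hfreq.mono fun k hk => ⟨hnot k, hk⟩)
  -- `u` enters the support only in state `k + 1`, so the contradictory selection is sought from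
  -- there on.
  obtain ⟨j, hj, hju⟩ := frequently_atTop.1 hfreq (k + 1)
  have hmem : u ∈ (x (k + 1)).support := by
    rw [(hit k).2, hk]
    exact Or.inr ⟨rfl, hkd⟩
  exact (hju ▸ hcand j).2 (hex.support_mono hj hmem)

end GPILS

end MORL

theorem theorem3 {S A Mem : Type*} [Finite S] [Finite A] [Nonempty A]
    [MeasurableSpace S] [DiscreteMeasurableSpace S]
    [MeasurableSpace A] [DiscreteMeasurableSpace A]
    {m : ℕ} [NeZero m] (M : MORL.MOMDP S A m) (ε : ℝ)
    (NewPolicy : MORL.NewPolicyProc S A Mem m) (c₀ : Mem)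
    (hNew : MORL.EpsOptimalWhenDone M NewPolicy ε) :
    -- the algorithm never gets stuck: while it has not returned, an iteration is possible
    (∀ x, MORL.Reachable M NewPolicy c₀ x → ¬ x.Returns M →
      ∃ w y, MORL.Iteration M NewPolicy x w y) ∧
    -- whatever it returns is an `ε`-CCS
    (∀ x, MORL.Reachable M NewPolicy c₀ x → x.Returns M → M.IsEpsCCS ε x.policies) ∧
    -- it returns, after finitely many iterations
    (∀ (x : ℕ → MORL.State S A Mem m) (w : ℕ → MORL.Weight m),
      MORL.IsExecution M NewPolicy c₀ x w → MORL.EventuallyDone M NewPolicy x w →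
      ∃ n, (x n).Returns M ∧ M.IsEpsCCS ε (x n).policies) := by
  refine ⟨fun x _ hnot => ?_, fun x hx hret => hx.isEpsCCS_of_returns hNew hret,
    fun x w hex hdone => ?_⟩
  · obtain ⟨w, hw⟩ := MORL.State.exists_selects hnot
    exact ⟨w, _, hw, rfl⟩
  · obtain ⟨n, hn⟩ := hex.exists_returns hdone
    exact ⟨n, hn, (hex.reachable n).isEpsCCS_of_returns hNew hn⟩
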